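/- **Corollary 3.8.** For $r>1$ let $\mathcal E_r\subset\mathbb C$ be the open Bernstein ellipse of radius $r$, i.e. the interior of the ellipse with foci $-1$ and $1$ and sum of the semi-axes equal to $r$, and let $\partial\mathcal E_r$ be its boundary. *Cross approximation with complete pivoting.* Given a function $f:X\times Y\to\mathbb R$, put $e_0=f$, and for $k=0,1,\dots,m-1$ choose $(x_{k+1},y_{k+1})\in X\times Y$ at which $|e_k|$ attains its maximum over $X\times Y$ (ties may be broken arbitrarily) and put $$e_{k+1}(x,y)=e_k(x,y)-\frac{e_k(x_{k+1},y)\,e_k(x,y_{k+1})}{e_k(x_{k+1},y_{k+1})}$$ (if $e_k=0$, put $e_{k+1}=0$). For $X=Y=[-1,1]$ this is cross approximation of functions with complete pivoting; for $X=Y=\{1,\dots,n\}$ it is complete pivoting applied to an $n\times n$ matrix $A$, and the resulting $e_k$ is denoted by $A^{(k)}$. Write $\|g\|_{\max}=\sup_{X\times Y}|g|$. *Growth factor.* Let $\rho_k=\sup_A \|A^{(k)}\|_{\max}/\|A\|_{\max}$, the supremum being taken over all real square matrices $A$ of any size and of rank at least $k$, and over all admissible choices of pivots. Let $f:[-1,1]^2\to\mathbb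 R$ and $1<r<r_0$ be such that, for each $y\in[-1,1]$, the function $f(\cdot,y)$ admits an analytic extension $\tilde f(\cdot,y)$ to $\mathcal E_{r_0}$, and suppose that $$M:=\sup_{\eta\in\partial\mathcal E_r,\ \xi\in[-1,1]}|\tilde f(\eta,\xi)|<\infty .$$ Let $m\ge 1$. After any $m$ steps of cross approximation of $f$ with complete pivoting (where it is assumed that the maxima that define the pivots are attained) the error function $e_m$ is bounded and satisfies $$\|e_m\|_{\max}\le\frac{2M\rho_m}{1-1/r}\cdot\Big(\frac r4\Big)^{-m}.$$ -/

import Mathlib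

/-- The max-norm `sup |g(s, t)|` of a real function of two variables; for finite `X`, `Y` it is
the largest modulus of the entries of a matrix. -/
noncomputable def maxNorm {X Y : Type*} (g : X → Y → ℝ) : ℝ :=
  ⨆ p : X × Y, |g p.1 p.2|

/-- The error function (remainder) `e_k` after `k` steps of cross approximation of `f` with the
pivot positions `(x 0, y 0), (x 1, y 1), …`:
`e_0 = f` and `e_{k+1} = e_k - e_k(x_k, ·) e_k(·, y_k) / e_k(x_k, y_k)`.
With `X = Y = Fin n` this is the remainder of cross approximation (Gaussian elimination) of an
`n × n` matrix. If pivots of maximum modulus are used and such a pivot is `0`, then `e_k = 0`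
already, and the convention `a / 0 = 0` gives `e_{k+1} = 0` as well. -/
noncomputable def crossError {X Y : Type*} (f : X → Y → ℝ) (x : ℕ → X) (y : ℕ → Y) :
    ℕ → X → Y → ℝ
  | 0 => f
  | k + 1 => fun s t =>
      crossError f x y k s t -
        crossError f x y k (x k) t * crossError f x y k s (y k) / crossError f x y k (x k) (y k)

/-- The positions `(x k, y k)`, `k < m`, are admissible choices for `m` steps of complete pivoting:
in each step `|e_k|` attains its maximum at `(x k, y k)`. Ties may be broken in any way. -/
def IsCompletePivoting {X Y : Type*} (f : X → Y → ℝ) (x : ℕ → X) (y : ℕ → Y) (m : ℕ) : Prop :=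
  ∀ k < m, ∀ s t, |crossError f x y k s t| ≤ |crossError f x y k (x k) (y k)|

/-- The growth factor `ρ_k` of complete pivoting: the supremum of `‖A^{(k)}‖_max / ‖A‖_max` over all
real square matrices `A` (of any size) of rank at least `k`, where `A^{(k)}` is what remains after
`k` steps with complete pivoting (the rows and columns already eliminated are `0` in the
remainder and do not contribute). The set is bounded above by `2 ^ k`. -/
noncomputable def growthFactor (k : ℕ) : ℝ :=
  sSup {c : ℝ | ∃ (n : ℕ) (A : Matrix (Fin n) (Fin n) ℝ) (i j : ℕ → Fin n),
    k ≤ A.rank ∧ IsCompletePivoting A i j k ∧ c = maxNorm (crossError A i j k) / maxNorm A}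

/-- The (open, filled) Bernstein ellipse of radius `r > 1`, with foci `-1` and `1` and with sum of
the semi-axes `r`: the semi-axes are `(r + r⁻¹) / 2` and `(r - r⁻¹) / 2`, and the sum of the
distances to the foci is smaller than the length `r + r⁻¹` of the major axis. -/
def bernsteinEllipse (r : ℝ) : Set ℂ :=
  {z : ℂ | ‖z - 1‖ + ‖z + 1‖ < r + r⁻¹}

/-!
Let `d_k` be the pivots and let `d_m` be the entry `(s, t)` of `e_m` to be estimated; it may be
assumed nonzero, and then no `d_k` vanishes. Let `A` be the matrix of order `m + 1` formed by the
values of `f` on the pivot rows and `s` and on the pivot columns and `t`.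

*Stability.* Complete pivoting makes all multipliers at most `1` in modulus. Hence forward
elimination for `A v = w` at most doubles the right-hand side in each step, and back substitution at
most doubles the `ℓ¹` norm of the solution in each step, which gives
`‖v‖₁ ≤ ‖A v‖_∞ ∑ k ≤ m, 4 ^ k / |d_k|` (`IsCompletePivoting.sum_abs_le`). In particular `A` is
nonsingular, so that it and its remainders compete in the definition of the growth factors `ρ`.
Bordering a matrix by one large diagonal entry delays the elimination by a step; this gives
`|d_m| ≤ ρ_m |d_k|` for all `k < m` (`abs_pivot_le_growthFactor_add_mul`) and `2 ≤ ρ_m`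
(`two_le_growthFactor`).

*Approximation.* Suppose that `f` is within `ε` of a sum of `m` products `φ_k(s) a_k(t)`. Some
`v ≠ 0` is annihilated by that sum, so `‖A v‖_∞ ≤ ε ‖v‖₁`, and stability gives
`|d_m| ≤ ε ∑ k ≤ m, 4 ^ k |d_m| / |d_k| ≤ ε (4 ^ m + ρ_m 4 ^ m / 3) ≤ 4 ^ m ρ_m ε`
(`IsCompletePivoting.abs_crossError_le_of_separable_approximation`).

*Chebyshev series.* The function `F ((w + 1 / w) / 2)` is analytic in an annulus around
`1 / r ≤ |w| ≤ r`. By Cauchy's estimate its Laurent coefficient of order `n` is at most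
`M r ^ (-|n|)`, and on `|w| = 1` its Laurent series is the Chebyshev series of `F` on `[-1, 1]`.
Truncation after `m` terms leaves the error `ε = 2 M r ^ (-m) / (1 - 1 / r)`
(`exists_chebyshev_approximation`).
-/

/-! ### Elimination with complete pivoting -/

section CrossError

variable {X Y : Type*}

theorem crossError_succ (f : X → Y → ℝ) (x : ℕ → X) (y : ℕ → Y) (k : ℕ) (s : X) (t : Y) :
    crossError f x y (k + 1) s t = crossError f x y k s t -
      crossError f x y k (x k) t * crossError f x y k s (y k) /
        crossError f x y k (x k) (y k) := rfl

theorem crossError_comp {X' Y' : Type*} (f : X → Y → ℝ) (p : X' → X) (q : Y' → Y)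
    (x : ℕ → X') (y : ℕ → Y') (k : ℕ) (s : X') (t : Y') :
    crossError (fun i j => f (p i) (q j)) x y k s t =
      crossError f (fun n => p (x n)) (fun n => q (y n)) k (p s) (q t) := by
  induction k generalizing s t with
  | zero => rfl
  | succ k ih => simp only [crossError_succ, ih]

theorem crossError_congr (f : X → Y → ℝ) {x x' : ℕ → X} {y y' : ℕ → Y} {k : ℕ}
    (hx : ∀ i < k, x i = x' i) (hy : ∀ i < k, y i = y' i) :
    crossError f x y k = crossError f x' y' k := by
  induction k with
  | zero => rfl
  | succ k ih =>
    have := ih (fun i hi => hx i (by omega)) (fun i hi => hy i (by omega))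
    funext s t
    simp only [crossError_succ, this, hx k (by omega), hy k (by omega)]

theorem crossError_crossError (f : X → Y → ℝ) (x : ℕ → X) (y : ℕ → Y) (a b : ℕ) :
    crossError (crossError f x y a) (fun n => x (a + n)) (fun n => y (a + n)) b =
      crossError f x y (a + b) := by
  induction b with
  | zero => rfl
  | succ b ih =>
    funext s t
    rw [← add_assoc, crossError_succ, crossError_succ, ih]

theorem crossError_apply_pivot_column (f : X → Y → ℝ) (x : ℕ → X) (y : ℕ → Y) {k j : ℕ}
    (hd : ∀ i < k, crossError f x y i (x i) (y i) ≠ 0) (hj : j < k) (s : X) :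
    crossError f x y k s (y j) = 0 := by
  induction k generalizing s with
  | zero => omega
  | succ k ih =>
    have ih := fun h s => ih (fun i hi => hd i (by omega)) h s
    rcases Nat.lt_succ_iff_lt_or_eq.mp hj with h | rfl
    · simp [crossError_succ, ih h]
    · rw [crossError_succ, mul_div_cancel_left₀ _ (hd j (by omega)), sub_self]

theorem IsCompletePivoting.mono {f : X → Y → ℝ} {x : ℕ → X} {y : ℕ → Y} {m n : ℕ}
    (h : IsCompletePivoting f x y m) (hn : n ≤ m) : IsCompletePivoting f x y n :=
  fun k hk => h k (by omega)

theorem IsCompletePivoting.shift {f : X → Y → ℝ} {x : ℕ → X} {y : ℕ → Y} {a m : ℕ}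
    (h : IsCompletePivoting f x y (a + m)) :
    IsCompletePivoting (crossError f x y a) (fun n => x (a + n)) (fun n => y (a + n)) m := by
  intro k hk s t
  rw [crossError_crossError]
  exact h (a + k) (by omega) s t

theorem IsCompletePivoting.comp {X' Y' : Type*} {f : X → Y → ℝ} {p : X' → X} {q : Y' → Y}
    {x : ℕ → X'} {y : ℕ → Y'} {m : ℕ}
    (h : IsCompletePivoting f (fun n => p (x n)) (fun n => q (y n)) m) :
    IsCompletePivoting (fun i j => f (p i) (q j)) x y m := by
  intro k hk s t
  rw [crossError_comp f p q, crossError_comp f p q]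
  exact h k hk _ _

theorem IsCompletePivoting.congr {f : X → Y → ℝ} {x x' : ℕ → X} {y y' : ℕ → Y} {m : ℕ}
    (h : IsCompletePivoting f x y m)
    (hx : ∀ i < m, x i = x' i) (hy : ∀ i < m, y i = y' i) : IsCompletePivoting f x' y' m := by
  intro k hk s t
  rw [← crossError_congr f (fun i hi => hx i (by omega)) (fun i hi => hy i (by omega)),
    ← hx k hk, ← hy k hk]
  exact h k hk s t

/-- The term subtracted in an elimination step with multiplier `b / d`, `|b| ≤ |d|`, is bounded by the
entry `a` of the pivot row. With `d = 0` the quotient is `0` and the bound still holds. -/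
theorem abs_mul_div_le {a b d : ℝ} (h : |b| ≤ |d|) : |a * b / d| ≤ |a| := by
  rw [mul_div_assoc, abs_mul, abs_div]
  exact mul_le_of_le_one_right (abs_nonneg _) (div_le_one_of_le₀ h (abs_nonneg _))

theorem IsCompletePivoting.abs_crossError_le {f : X → Y → ℝ} {x : ℕ → X} {y : ℕ → Y} {m : ℕ}
    (h : IsCompletePivoting f x y m) {C : ℝ} (hC : ∀ s t, |f s t| ≤ C) (s : X) (t : Y) :
    |crossError f x y m s t| ≤ 2 ^ m * C := by
  induction m generalizing s t with
  | zero => simpa [crossError] using hC s t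
  | succ m ih =>
    have ih := ih (h.mono (Nat.le_succ m))
    rw [crossError_succ, pow_succ]
    have h1 := abs_sub (crossError f x y m s t)
      (crossError f x y m (x m) t * crossError f x y m s (y m) / crossError f x y m (x m) (y m))
    have h2 := abs_mul_div_le (a := crossError f x y m (x m) t) (h m (Nat.lt_succ_self m) s (y m))
    linarith [ih s t, ih (x m) t]

theorem IsCompletePivoting.pivot_ne_zero {f : X → Y → ℝ} {x : ℕ → X} {y : ℕ → Y} {m k : ℕ}
    (h : IsCompletePivoting f x y m) (hk : k < m) {s : X} {t : Y}
    (hne : crossError f x y m s t ≠ 0) : crossError f x y k (x k) (y k) ≠ 0 := by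
  intro h0
  obtain ⟨b, rfl⟩ := Nat.exists_eq_add_of_le hk.le
  have := h.shift.abs_crossError_le (C := 0) (fun s t => by simpa [h0] using h k hk s t) s t
  rw [crossError_crossError, mul_zero] at this
  exact hne (abs_nonpos_iff.mp this)

/-- A bound for the inverse of the matrix `f (x i) (y j)`, `i, j ≤ m`, as an operator from the
supremum norm to the `ℓ¹` norm. Forward elimination at most doubles the right-hand side in each
step, and back substitution at most doubles the `ℓ¹` norm of the solution. -/
theorem IsCompletePivoting.sum_abs_le {f : X → Y → ℝ} {x : ℕ → X} {y : ℕ → Y} {m : ℕ}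
    (h : IsCompletePivoting f x y m) (hd : ∀ k ≤ m, crossError f x y k (x k) (y k) ≠ 0)
    (v : ℕ → ℝ) {ε : ℝ}
    (hv : ∀ i ≤ m, |∑ j ∈ Finset.range (m + 1), f (x i) (y j) * v j| ≤ ε) :
    ∑ j ∈ Finset.range (m + 1), |v j| ≤
      ε * ∑ k ∈ Finset.range (m + 1), 4 ^ k / |crossError f x y k (x k) (y k)| := by
  have forward : ∀ k ≤ m, ∀ i ≤ m,
      |∑ j ∈ Finset.range (m + 1), crossError f x y k (x i) (y j) * v j| ≤ 2 ^ k * ε := by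
    intro k
    induction k with
    | zero => intro _ i hi; simpa [crossError] using hv i hi
    | succ k ih =>
      intro hk i hi
      have e : ∑ j ∈ Finset.range (m + 1), crossError f x y (k + 1) (x i) (y j) * v j =
          ∑ j ∈ Finset.range (m + 1), crossError f x y k (x i) (y j) * v j -
          (∑ j ∈ Finset.range (m + 1), crossError f x y k (x k) (y j) * v j) *
            crossError f x y k (x i) (y k) / crossError f x y k (x k) (y k) := by
        rw [Finset.sum_mul, Finset.sum_div, ← Finset.sum_sub_distrib]
        refine Finset.sum_congr rfl fun j _ => ?_
        rw [crossError_succ]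
        ring
      rw [e, pow_succ]
      refine (abs_sub _ _).trans ?_
      have h2 := abs_mul_div_le
        (a := ∑ j ∈ Finset.range (m + 1), crossError f x y k (x k) (y j) * v j)
        (h k hk (x i) (y k))
      linarith [ih (by omega) i hi, ih (by omega) k (by omega)]
  have step : ∀ k ≤ m, ∑ j ∈ Finset.Ico k (m + 1), |v j| ≤
      2 * ∑ j ∈ Finset.Ico (k + 1) (m + 1), |v j| +
        2 ^ k * ε / |crossError f x y k (x k) (y k)| := by
    intro k hk
    have h0 := forward k hk k hk
    rw [Finset.range_eq_Ico, ← Finset.sum_Ico_consecutive _ (Nat.zero_le k) (by omega : k ≤ m + 1),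
      Finset.sum_eq_zero (s := Finset.Ico 0 k), zero_add,
      Finset.sum_eq_sum_Ico_succ_bot (by omega)] at h0
    swap
    · intro j hj
      rw [crossError_apply_pivot_column f x y (fun i hi => hd i (by omega))
        (Finset.mem_Ico.mp hj).2, zero_mul]
    have hpos : 0 < |crossError f x y k (x k) (y k)| := abs_pos.mpr (hd k hk)
    have h1 : |∑ j ∈ Finset.Ico (k + 1) (m + 1), crossError f x y k (x k) (y j) * v j| ≤
        |crossError f x y k (x k) (y k)| * ∑ j ∈ Finset.Ico (k + 1) (m + 1), |v j| := by
      rw [Finset.mul_sum]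
      refine (Finset.abs_sum_le_sum_abs _ _).trans (Finset.sum_le_sum fun j hj => ?_)
      rw [abs_mul]
      have := Finset.mem_Ico.mp hj
      exact mul_le_mul_of_nonneg_right (h k (by omega) _ _) (abs_nonneg _)
    have h2 : |crossError f x y k (x k) (y k)| * |v k| ≤ 2 ^ k * ε +
        |crossError f x y k (x k) (y k)| * ∑ j ∈ Finset.Ico (k + 1) (m + 1), |v j| := by
      rw [← abs_mul]
      have := abs_sub_abs_le_abs_sub (crossError f x y k (x k) (y k) * v k)
        (-∑ j ∈ Finset.Ico (k + 1) (m + 1), crossError f x y k (x k) (y j) * v j)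
      rw [abs_neg, sub_neg_eq_add] at this
      linarith
    rw [Finset.sum_eq_sum_Ico_succ_bot (by omega)]
    have h3 : |v k| ≤ 2 ^ k * ε / |crossError f x y k (x k) (y k)| +
        ∑ j ∈ Finset.Ico (k + 1) (m + 1), |v j| := by
      rw [← sub_le_iff_le_add, le_div_iff₀ hpos]
      linarith
    linarith
  have back : ∀ k ≤ m + 1, ∑ j ∈ Finset.range (m + 1), |v j| ≤
      2 ^ k * ∑ j ∈ Finset.Ico k (m + 1), |v j| +
        ε * ∑ i ∈ Finset.range k, 4 ^ i / |crossError f x y i (x i) (y i)| := by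
    intro k
    induction k with
    | zero => simp
    | succ k ih =>
      intro hk
      refine (ih (by omega)).trans ?_
      have := mul_le_mul_of_nonneg_left (step k (by omega)) (pow_nonneg zero_le_two k : (0:ℝ) ≤ 2 ^ k)
      rw [Finset.sum_range_succ, pow_succ]
      have e : (4 : ℝ) ^ k = 2 ^ k * 2 ^ k := by rw [← mul_pow]; norm_num
      rw [e]
      refine (add_le_add_left this _).trans_eq ?_
      ring
  simpa using back (m + 1) le_rfl

end CrossError

/-! ### Lower bounds for the growth factor -/

section GrowthFactor

theorem abs_le_maxNorm {X Y : Type*} [Finite X] [Finite Y] (g : X → Y → ℝ) (s : X) (t : Y) :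
    |g s t| ≤ maxNorm g :=
  le_ciSup (f := fun p : X × Y => |g p.1 p.2|) (Set.finite_range _).bddAbove (s, t)

theorem maxNorm_nonneg {X Y : Type*} (g : X → Y → ℝ) : 0 ≤ maxNorm g :=
  Real.iSup_nonneg fun _ => abs_nonneg _

theorem maxNorm_le {X Y : Type*} {g : X → Y → ℝ} {C : ℝ} (hC : 0 ≤ C)
    (h : ∀ s t, |g s t| ≤ C) : maxNorm g ≤ C :=
  Real.iSup_le (fun p => h p.1 p.2) hC

theorem le_growthFactor {n k : ℕ} (A : Matrix (Fin n) (Fin n) ℝ) (i j : ℕ → Fin n)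
    (hk : k ≤ A.rank) (h : IsCompletePivoting A i j k) :
    maxNorm (crossError A i j k) / maxNorm A ≤ growthFactor k := by
  refine le_csSup ⟨2 ^ k, ?_⟩ ⟨n, A, i, j, hk, h, rfl⟩
  rintro c ⟨n, A, i, j, -, h, rfl⟩
  exact div_le_of_le_mul₀ (maxNorm_nonneg _) (by positivity)
    (maxNorm_le (mul_nonneg (by positivity) (maxNorm_nonneg _))
      (h.abs_crossError_le (abs_le_maxNorm A)))

/-- The leading square submatrix on the first `m + 1` pivot rows and columns competes in the
supremum that defines the growth factor; it is nonsingular since its pivots do not vanish. -/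
theorem abs_pivot_le_growthFactor_mul {X Y : Type*} {f : X → Y → ℝ} {x : ℕ → X} {y : ℕ → Y}
    {m : ℕ} (h : IsCompletePivoting f x y m)
    (hd : ∀ k ≤ m, crossError f x y k (x k) (y k) ≠ 0) (hm : 0 < m) :
    |crossError f x y m (x m) (y m)| ≤ growthFactor m * |f (x 0) (y 0)| := by
  set A : Matrix (Fin (m + 1)) (Fin (m + 1)) ℝ := fun i j => f (x i) (y j) with hA
  have hfin : ∀ k < m + 1, ((Fin.ofNat (m + 1) k : Fin (m + 1)) : ℕ) = k :=
    fun k hk => Nat.mod_eq_of_lt hk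
  have hAc : IsCompletePivoting A (Fin.ofNat (m + 1)) (Fin.ofNat (m + 1)) m :=
    IsCompletePivoting.comp (p := fun i : Fin (m + 1) => x i) (q := fun i : Fin (m + 1) => y i)
      (h.congr (fun i hi => by rw [hfin i (by omega)]) (fun i hi => by rw [hfin i (by omega)]))
  have hrank : m ≤ A.rank := by
    rw [Matrix.rank_of_isUnit, Fintype.card_fin]
    · exact Nat.le_succ m
    rw [← Matrix.mulVec_injective_iff_isUnit]
    refine (injective_iff_map_eq_zero A.mulVecLin).mpr fun v hv => ?_
    have hs := h.sum_abs_le hd (fun j => v (Fin.ofNat (m + 1) j)) (ε := 0) fun i hi => by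
      have h1 : ∑ j : Fin (m + 1), f (x i) (y j) * v j = 0 := congrFun hv ⟨i, by omega⟩
      rw [Finset.sum_range]
      simp [h1]
    rw [zero_mul, Finset.sum_range] at hs
    funext j
    have := (Finset.sum_eq_zero_iff_of_nonneg (fun _ _ => abs_nonneg _)).mp
      (le_antisymm hs (Finset.sum_nonneg fun _ _ => abs_nonneg _)) j (Finset.mem_univ _)
    simpa using this
  have hnorm : maxNorm A = |f (x 0) (y 0)| :=
    le_antisymm (maxNorm_le (abs_nonneg _) fun i j => h 0 hm _ _) (abs_le_maxNorm A 0 0)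
  have hpos : 0 < |f (x 0) (y 0)| := abs_pos.mpr (hd 0 (Nat.zero_le m))
  have hlast : |crossError f x y m (x m) (y m)| ≤
      maxNorm (crossError A (Fin.ofNat (m + 1)) (Fin.ofNat (m + 1)) m) := by
    have := abs_le_maxNorm (crossError A (Fin.ofNat (m + 1)) (Fin.ofNat (m + 1)) m)
      (Fin.last m) (Fin.last m)
    rw [hA, crossError_comp f (fun i : Fin (m + 1) => x i) (fun i : Fin (m + 1) => y i),
      crossError_congr f (x' := x) (y' := y) (fun i hi => by rw [hfin i (by omega)])
        (fun i hi => by rw [hfin i (by omega)])] at this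
    simpa using this
  have := le_growthFactor A _ _ hrank hAc
  rw [hnorm, div_le_iff₀ hpos] at this
  exact hlast.trans this

/-- The function `f` bordered by one row and one column that vanish except for the corner `c`. -/
def bordered {X Y : Type*} (c : ℝ) (f : X → Y → ℝ) : Option X → Option Y → ℝ
  | some s, some t => f s t
  | none, none => c
  | _, _ => 0

theorem crossError_bordered {X Y : Type*} {c : ℝ} (hc : c ≠ 0) (f : X → Y → ℝ) (x : ℕ → X)
    (y : ℕ → Y) (k : ℕ) :
    crossError (bordered c f) (fun n => Nat.casesOn n none fun i => some (x i))
      (fun n => Nat.casesOn n none fun i => some (y i)) (k + 1) =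
      bordered 0 (crossError f x y k) := by
  induction k with
  | zero =>
    funext s t
    cases s <;> cases t <;> simp [crossError, bordered, hc]
  | succ k ih =>
    funext s t
    rw [crossError_succ, ih]
    cases s <;> cases t <;> simp [crossError_succ, bordered]

/-- Bordering by an entry as large as the first pivot delays the elimination by one step, so the
growth observed after `m` steps is also a lower bound for later growth factors. -/
theorem abs_pivot_le_growthFactor_add_mul (l : ℕ) {X Y : Type*} {f : X → Y → ℝ} {x : ℕ → X}
    {y : ℕ → Y} {m : ℕ} (h : IsCompletePivoting f x y m)
    (hd : ∀ k ≤ m, crossError f x y k (x k) (y k) ≠ 0) (hm : 0 < m) :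
    |crossError f x y m (x m) (y m)| ≤ growthFactor (m + l) * |f (x 0) (y 0)| := by
  induction l generalizing X Y m with
  | zero => exact abs_pivot_le_growthFactor_mul h hd hm
  | succ l ih =>
    have hc : f (x 0) (y 0) ≠ 0 := hd 0 (Nat.zero_le m)
    have := ih (f := bordered (f (x 0) (y 0)) f)
      (x := fun n => Nat.casesOn n none fun i => some (x i))
      (y := fun n => Nat.casesOn n none fun i => some (y i)) (m := m + 1) ?_ ?_ (Nat.succ_pos m)
    · rw [crossError_bordered hc, add_right_comm] at this
      exact this
    · intro k hk s t
      cases k with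
      | zero =>
        cases s <;> cases t <;> simp [crossError, bordered]
        exact h 0 hm _ _
      | succ k =>
        rw [crossError_bordered hc]
        cases s <;> cases t <;> simp [bordered]
        exact h k (by omega) _ _
    · intro k hk
      cases k with
      | zero => exact hc
      | succ k =>
        rw [crossError_bordered hc]
        exact hd k (by omega)

theorem two_le_growthFactor {m : ℕ} (hm : 0 < m) : 2 ≤ growthFactor m := by
  -- The matrix with rows `(1, -1)` and `(1, 1)` has the pivots `1` and `2`.
  let A : Fin 2 → Fin 2 → ℝ := ![![1, -1], ![1, 1]]
  have h1 : crossError A (Fin.ofNat 2) (Fin.ofNat 2) 1 1 1 = 2 := by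
    simp [crossError, A]; norm_num
  have := abs_pivot_le_growthFactor_add_mul (m - 1) (f := A) (x := Fin.ofNat 2) (y := Fin.ofNat 2)
    (m := 1) ?_ ?_ one_pos
  · rw [Nat.add_sub_cancel' hm] at this
    change |crossError A (Fin.ofNat 2) (Fin.ofNat 2) 1 1 1| ≤ _ * |(1 : ℝ)| at this
    simpa [h1] using this
  · intro k hk s t
    obtain rfl : k = 0 := by omega
    fin_cases s <;> fin_cases t <;> simp [crossError, A]
  · intro k hk
    interval_cases k
    · exact one_ne_zero (α := ℝ)
    · exact h1.trans_ne two_ne_zero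

end GrowthFactor

/-! ### Chebyshev expansion of functions analytic in a Bernstein ellipse -/

section Chebyshev

open Complex MeasureTheory Metric Filter Topology
open scoped Real

/-- The Joukowski map, which sends the circles `|w| = r` and `|w| = 1 / r` onto the boundary of the
Bernstein ellipse of radius `r`. -/
noncomputable def joukowski (w : ℂ) : ℂ := (w + w⁻¹) / 2

theorem joukowski_inv (w : ℂ) : joukowski w⁻¹ = joukowski w := by
  rw [joukowski, joukowski, inv_inv, add_comm]

theorem joukowski_exp_mul_I (θ : ℂ) : joukowski (exp (θ * I)) = cos θ := by
  rw [joukowski, ← Complex.exp_neg, cos, neg_mul]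

theorem differentiableAt_joukowski {w : ℂ} (hw : w ≠ 0) : DifferentiableAt ℂ joukowski w :=
  (differentiableAt_id.add (differentiableAt_inv hw)).div_const 2

theorem norm_joukowski_sub_one_add {w : ℂ} (hw : w ≠ 0) :
    ‖joukowski w - 1‖ + ‖joukowski w + 1‖ = ‖w‖ + ‖w‖⁻¹ := by
  have h1 : joukowski w - 1 = (w - 1) * (w - 1) / (2 * w) := by
    rw [joukowski]; field_simp; ring
  have h2 : joukowski w + 1 = (w + 1) * (w + 1) / (2 * w) := by
    rw [joukowski]; field_simp; ring
  have h3 := parallelogram_law_with_norm ℂ w 1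
  have h4 : ‖w‖ ≠ 0 := norm_ne_zero_iff.mpr hw
  rw [norm_one] at h3
  rw [h1, h2, norm_div, norm_div, norm_mul, norm_mul, norm_mul, Complex.norm_two]
  field_simp
  linarith

theorem joukowski_mem_bernsteinEllipse {r : ℝ} {w : ℂ} (h1 : 1 < r * ‖w‖) (h2 : ‖w‖ < r) :
    joukowski w ∈ bernsteinEllipse r := by
  have hr : 0 < r := (norm_nonneg w).trans_lt h2
  have hw : 0 < ‖w‖ := pos_of_mul_pos_right (one_pos.trans h1) hr.le
  rw [bernsteinEllipse, Set.mem_ofPred_eq, norm_joukowski_sub_one_add (norm_pos_iff.mp hw)]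
  have h : r + r⁻¹ - (‖w‖ + ‖w‖⁻¹) = (r - ‖w‖) * (r * ‖w‖ - 1) / (r * ‖w‖) := by
    field_simp; ring
  have : 0 < (r - ‖w‖) * (r * ‖w‖ - 1) / (r * ‖w‖) :=
    div_pos (mul_pos (sub_pos.mpr h2) (sub_pos.mpr h1)) (mul_pos hr hw)
  linarith

theorem isOpen_bernsteinEllipse (r : ℝ) : IsOpen (bernsteinEllipse r) :=
  isOpen_lt (by fun_prop) continuous_const

theorem joukowski_mem_frontier {r : ℝ} (hr : 1 < r) {w : ℂ} (hw : ‖w‖ = r) :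
    joukowski w ∈ frontier (bernsteinEllipse r) := by
  have hr0 : 0 < r := one_pos.trans hr
  have hw0 : w ≠ 0 := norm_pos_iff.mp (hw ▸ hr0)
  rw [frontier, (isOpen_bernsteinEllipse r).interior_eq]
  refine ⟨?_, fun h => ?_⟩
  · -- Approach `w` along its ray from the inside of the disk.
    have hcont : ContinuousAt (fun t : ℝ => joukowski (t * w)) 1 := by
      refine ContinuousAt.comp (g := joukowski) (f := fun t : ℝ => (t : ℂ) * w) ?_ (by fun_prop)
      exact (differentiableAt_joukowski (by simpa using hw0)).continuousAt
    have ht : Tendsto (fun t : ℝ => joukowski (t * w)) (𝓝[<] 1) (𝓝 (joukowski w)) := by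
      simpa using hcont.tendsto.mono_left nhdsWithin_le_nhds
    refine mem_closure_of_tendsto ht ?_
    filter_upwards [Ioo_mem_nhdsLT (inv_lt_one_of_one_lt₀ hr)] with t ht
    have ht0 : 0 < t := (inv_pos.mpr hr0).trans ht.1
    have hn : ‖(t : ℂ) * w‖ = t * r := by
      rw [norm_mul, hw, Complex.norm_of_nonneg ht0.le]
    apply joukowski_mem_bernsteinEllipse <;> rw [hn]
    · have : 1 < t * r := (inv_lt_iff_one_lt_mul₀ hr0).mp ht.1
      nlinarith
    · nlinarith [ht.2]
  · rw [bernsteinEllipse, Set.mem_ofPred_eq, norm_joukowski_sub_one_add hw0, hw] at h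
    exact lt_irrefl _ h

/-- The Laurent coefficient of `w ^ n` of the function `F ∘ joukowski`. -/
noncomputable def laurentCoeff (F : ℂ → ℂ) (n : ℤ) : ℂ :=
  (2 * π * I : ℂ)⁻¹ • ∮ z in C(0, 1), (z - 0)⁻¹ • (z ^ (-n) * F (joukowski z))

variable {F : ℂ → ℂ} {r₀ : ℝ}

theorem differentiableAt_zpow_mul_joukowski (hF : AnalyticOnNhd ℂ F (bernsteinEllipse r₀)) {z : ℂ}
    (h1 : 1 < r₀ * ‖z‖) (h2 : ‖z‖ < r₀) (n : ℤ) :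
    DifferentiableAt ℂ (fun z => z ^ (-n) * F (joukowski z)) z := by
  have hz : z ≠ 0 := by
    rintro rfl
    norm_num at h1
  exact (differentiableAt_zpow.mpr (Or.inl hz)).mul
    ((hF _ (joukowski_mem_bernsteinEllipse h1 h2)).differentiableAt.comp z
      (differentiableAt_joukowski hz))

theorem circleIntegral_joukowski_eq (hF : AnalyticOnNhd ℂ F (bernsteinEllipse r₀)) (n : ℤ)
    {a b : ℝ} (ha : 1 < r₀ * a) (ha0 : 0 < a) (hab : a ≤ b) (hb : b < r₀) :
    (∮ z in C(0, b), (z - 0)⁻¹ • (z ^ (-n) * F (joukowski z))) =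
      ∮ z in C(0, a), (z - 0)⁻¹ • (z ^ (-n) * F (joukowski z)) := by
  have hr₀ : 0 < r₀ := by linarith
  have hd : ∀ z : ℂ, a ≤ ‖z‖ → ‖z‖ ≤ b →
      DifferentiableAt ℂ (fun z => z ^ (-n) * F (joukowski z)) z := fun z h1 h2 =>
    differentiableAt_zpow_mul_joukowski hF
      (ha.trans_le (mul_le_mul_of_nonneg_left h1 hr₀.le)) (h2.trans_lt hb) n
  refine circleIntegral_sub_center_inv_smul_eq_of_differentiable_on_annulus_off_countable ha0 hab
    Set.countable_empty (fun z hz => ?_) (fun z hz => ?_)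
  · simp only [Set.mem_sdiff, mem_closedBall_zero_iff, mem_ball_zero_iff, not_lt] at hz
    exact (hd z hz.2 hz.1).continuousAt.continuousWithinAt
  · simp only [Set.mem_sdiff, mem_closedBall_zero_iff, mem_ball_zero_iff, not_le] at hz
    exact hd z hz.1.2.le hz.1.1.le

theorem norm_laurentCoeff_le_of_norm_le (hF : AnalyticOnNhd ℂ F (bernsteinEllipse r₀)) {ρ M : ℝ}
    (h1 : 1 < r₀ * ρ) (h2 : ρ < r₀) (hρ : 0 < ρ) (hr₀ : 1 < r₀)
    (hM : ∀ w, ‖w‖ = ρ → ‖F (joukowski w)‖ ≤ M) (n : ℤ) :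
    ‖laurentCoeff F n‖ ≤ M * ρ ^ (-n) := by
  have e : laurentCoeff F n =
      (2 * π * I : ℂ)⁻¹ • ∮ z in C(0, ρ), (z - 0)⁻¹ • (z ^ (-n) * F (joukowski z)) := by
    rw [laurentCoeff]
    congr 1
    rcases le_total ρ 1 with h | h
    · exact circleIntegral_joukowski_eq hF n h1 hρ h hr₀
    · exact (circleIntegral_joukowski_eq hF n (by simpa using hr₀) one_pos h h2).symm
  rw [e]
  refine (circleIntegral.norm_two_pi_i_inv_smul_integral_le_of_norm_le_const
    (C := ρ⁻¹ * (ρ ^ (-n) * M)) hρ.le fun z hz => ?_).trans_eq ?_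
  · rw [mem_sphere_zero_iff_norm] at hz
    rw [norm_smul, norm_mul, norm_inv, sub_zero, norm_zpow, hz]
    have := hM z hz
    gcongr
  · field_simp

/-- Cauchy's estimate on both boundary circles of the annulus `1 / r ≤ |w| ≤ r`. -/
theorem norm_laurentCoeff_le (hF : AnalyticOnNhd ℂ F (bernsteinEllipse r₀)) {r M : ℝ}
    (hr : 1 < r) (hr₀ : r < r₀) (hM : ∀ η ∈ frontier (bernsteinEllipse r), ‖F η‖ ≤ M) (n : ℕ) :
    ‖laurentCoeff F n‖ ≤ M * r⁻¹ ^ n ∧ ‖laurentCoeff F (-n)‖ ≤ M * r⁻¹ ^ n := by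
  have hr0 : 0 < r := one_pos.trans hr
  constructor
  · have := norm_laurentCoeff_le_of_norm_le hF (ρ := r) (by nlinarith) hr₀ hr0 (hr.trans hr₀)
      (fun w hw => hM _ (joukowski_mem_frontier hr hw)) n
    simpa using this
  · have := norm_laurentCoeff_le_of_norm_le hF (ρ := r⁻¹) (M := M)
      (by rwa [← div_eq_mul_inv, one_lt_div hr0])
      ((inv_lt_one_of_one_lt₀ hr).trans (hr.trans hr₀)) (inv_pos.mpr hr0) (hr.trans hr₀)
      (fun w hw => by
        rw [← joukowski_inv]
        exact hM _ (joukowski_mem_frontier hr (by rw [norm_inv, hw, inv_inv]))) (-n)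
    simpa using this

/-- On `[-1, 1]` the Laurent series of `F ∘ joukowski` becomes the Chebyshev series of `F`. -/
theorem hasSum_laurentCoeff_mul_cos (hF : AnalyticOnNhd ℂ F (bernsteinEllipse r₀)) (hr₀ : 1 < r₀)
    (hs : Summable fun n => laurentCoeff F n) (θ : ℝ) :
    HasSum (fun n : ℤ => laurentCoeff F n * Real.cos (n * θ)) (F (Real.cos θ)) := by
  have : Fact (0 < 2 * π) := ⟨Real.two_pi_pos⟩
  have hπ : (π : ℂ) ≠ 0 := ofReal_ne_zero.mpr Real.pi_ne_zero
  have hcirc : ∀ t : ℝ, ((AddCircle.toCircle (t : AddCircle (2 * π)) : Circle) : ℂ) =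
      exp (t * I) := by
    intro t
    rw [AddCircle.toCircle_apply_mk, div_self Real.two_pi_pos.ne', one_mul, Circle.coe_exp]
  have hcont : Continuous fun t : AddCircle (2 * π) =>
      F (joukowski ((AddCircle.toCircle t : Circle) : ℂ)) := by
    refine continuous_iff_continuousAt.mpr fun t => ?_
    have h := differentiableAt_zpow_mul_joukowski hF
      (z := ((AddCircle.toCircle t : Circle) : ℂ)) (by rwa [Circle.norm_coe, mul_one]) (by rwa [Circle.norm_coe]) 0
    simp only [neg_zero, zpow_zero, one_mul] at h
    exact ContinuousAt.comp (g := fun z => F (joukowski z)) h.continuousAt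
      (continuous_subtype_val.comp AddCircle.continuous_toCircle).continuousAt
  let G : C(AddCircle (2 * π), ℂ) := ⟨_, hcont⟩
  have hG : ∀ t : ℝ, G (t : AddCircle (2 * π)) = F (cos t) := by
    intro t
    change F (joukowski _) = _
    rw [hcirc, joukowski_exp_mul_I]
  have hfourier : ∀ (n : ℤ) (t : ℝ), fourier n (t : AddCircle (2 * π)) = exp (n * (t * I)) := by
    intro n t
    rw [fourier_coe_apply]
    push_cast
    congr 1
    field_simp
  have hcoeff : fourierCoeff G = laurentCoeff F := by
    funext n
    rw [fourierCoeff_eq_intervalIntegral _ _ 0, laurentCoeff, circleIntegral, zero_add]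
    have : ∀ t : ℝ, deriv (circleMap 0 1) t • ((circleMap 0 1 t - 0)⁻¹ •
        ((circleMap 0 1 t) ^ (-n) * F (joukowski (circleMap 0 1 t)))) =
        I * (fourier (-n) (t : AddCircle (2 * π)) • G (t : AddCircle (2 * π))) := by
      intro t
      have h0 : exp (t * I) ≠ 0 := exp_ne_zero _
      rw [hG, hfourier, deriv_circleMap, circleMap_zero, ofReal_one, one_mul,
        joukowski_exp_mul_I, Complex.exp_int_mul]
      simp only [smul_eq_mul, sub_zero]
      field_simp
    simp_rw [this]
    rw [intervalIntegral.integral_const_mul, Complex.real_smul, smul_eq_mul]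
    push_cast
    have := I_ne_zero
    field_simp
  have key : ∀ t : ℝ, HasSum (fun n : ℤ => laurentCoeff F n * exp (n * t * I)) (F (cos t)) := by
    intro t
    have := has_pointwise_sum_fourier_series_of_summable (f := G) (by rwa [hcoeff])
      (t : AddCircle (2 * π))
    simp only [hG, hcoeff, hfourier, smul_eq_mul] at this
    simpa only [mul_assoc] using this
  have h := ((key θ).add (key (-θ))).div_const 2
  have e1 : (F (cos (θ : ℂ)) + F (cos ((-θ : ℝ) : ℂ))) / 2 = F (Real.cos θ) := by
    rw [ofReal_neg, Complex.cos_neg, ofReal_cos]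
    ring
  rw [e1] at h
  convert! h using 2 with n
  rw [ofReal_cos, Complex.cos]
  push_cast
  ring_nf

theorem exists_chebyshev_approximation (hF : AnalyticOnNhd ℂ F (bernsteinEllipse r₀)) {r M : ℝ}
    (hr : 1 < r) (hr₀ : r < r₀) (hM : ∀ η ∈ frontier (bernsteinEllipse r), ‖F η‖ ≤ M)
    {m : ℕ} (hm : 0 < m) :
    ∃ a : ℕ → ℝ, ∀ θ : ℝ,
      |(F (Real.cos θ)).re - ∑ k ∈ Finset.range m, a k * Real.cos (k * θ)| ≤
        2 * M * r⁻¹ ^ m / (1 - r⁻¹) := by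
  have hr1 : r⁻¹ < 1 := inv_lt_one_of_one_lt₀ hr
  have hr0 : 0 < r⁻¹ := inv_pos.mpr (one_pos.trans hr)
  have hb := norm_laurentCoeff_le hF hr hr₀ hM
  have hg : Summable fun n : ℕ => M * r⁻¹ ^ n :=
    (summable_geometric_of_lt_one hr0.le hr1).mul_left M
  have hs : Summable fun n => laurentCoeff F n :=
    Summable.of_nat_of_neg (hg.of_norm_bounded fun n => (hb n).1)
      (hg.of_norm_bounded fun n => (hb n).2)
  -- In the sum over `±k` the term for `k = 0` is counted twice.
  refine ⟨fun k => (laurentCoeff F k + laurentCoeff F (-k) -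
    if k = 0 then laurentCoeff F 0 else 0).re, fun θ => ?_⟩
  have h := (hasSum_laurentCoeff_mul_cos hF (hr.trans hr₀) hs θ).nat_add_neg
  have ht := norm_sub_le_of_geometric_bound_of_hasSum hr1 (C := 2 * M) (fun n => ?_) h m
  · refine le_trans ?_ ht
    rw [norm_sub_rev]
    refine le_trans (le_of_eq ?_) (abs_re_le_norm _)
    congr 1
    rw [sub_re, add_re, add_sub_assoc]
    rw [sub_eq_add_neg]
    congr 1
    rw [eq_sub_iff_add_eq, re_sum, neg_add_eq_sub, ← Finset.sum_sub_distrib]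
    rw [Finset.sum_eq_single 0]
    · simp
    · intro k _ hk
      simp [hk, ← add_mul, -ofReal_cos, -mul_re, re_mul_ofReal]
    · intro h
      exact absurd (Finset.mem_range.mpr hm) h
  · have hc : ∀ c : ℂ, ∀ t : ℝ, ‖c * Real.cos t‖ ≤ ‖c‖ := fun c t => by
      rw [norm_mul, norm_real]
      exact mul_le_of_le_one_right (norm_nonneg _) (Real.abs_cos_le_one t)
    have h1 := (hc (laurentCoeff F n) (((n : ℤ) : ℝ) * θ)).trans (hb n).1
    have h2 := (hc (laurentCoeff F (-n)) (((-n : ℤ) : ℝ) * θ)).trans (hb n).2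
    refine (norm_add_le _ _).trans ?_
    linarith

end Chebyshev

/-! ### Cross approximation against separable approximation -/

section SeparableApproximation

/-- Complete pivoting loses at most the factor `4 ^ m * growthFactor m` against
any approximation of `f` by a sum of `m` products. -/
theorem IsCompletePivoting.abs_pivot_le_of_separable_approximation {X Y : Type*} {f : X → Y → ℝ}
    {x : ℕ → X} {y : ℕ → Y} {m : ℕ} (h : IsCompletePivoting f x y m)
    (hd : ∀ k ≤ m, crossError f x y k (x k) (y k) ≠ 0) (hm : 0 < m)
    (φ : ℕ → X → ℝ) (a : ℕ → Y → ℝ) {ε : ℝ}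
    (hε : ∀ s t, |f s t - ∑ k ∈ Finset.range m, a k t * φ k s| ≤ ε) :
    |crossError f x y m (x m) (y m)| ≤ 4 ^ m * growthFactor m * ε := by
  obtain ⟨v, hv, hv0⟩ := (Submodule.ne_bot_iff _).mp
    (LinearMap.ker_ne_bot_of_finrank_lt
      (f := (Matrix.of fun (k : Fin m) (j : Fin (m + 1)) => a k (y j)).mulVecLin) (by simp))
  have hv1 : ∀ k < m, ∑ j : Fin (m + 1), a k (y j) * v j = 0 := fun k hk =>
    congrFun (LinearMap.mem_ker.mp hv) ⟨k, hk⟩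
  set S := ∑ j : Fin (m + 1), |v j| with hS
  have hSpos : 0 < S := by
    obtain ⟨j, hj⟩ := Function.ne_iff.mp hv0
    exact Finset.sum_pos' (fun _ _ => abs_nonneg _) ⟨j, Finset.mem_univ _, abs_pos.mpr hj⟩
  have hsum := h.sum_abs_le hd (fun j => v (Fin.ofNat (m + 1) j)) (ε := ε * S) fun i _ => by
    rw [Finset.sum_range]
    simp only [Fin.ofNat_eq_cast, Fin.cast_val_eq_self]
    -- The approximant annihilates `v`, so `f` may be replaced by the approximation error.
    have e : ∑ j : Fin (m + 1), f (x i) (y j) * v j = ∑ j : Fin (m + 1),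
        (f (x i) (y j) - ∑ k ∈ Finset.range m, a k (y j) * φ k (x i)) * v j := by
      simp only [sub_mul, Finset.sum_sub_distrib, Finset.sum_mul]
      rw [Finset.sum_comm, eq_comm, sub_eq_self]
      refine Finset.sum_eq_zero fun k hk => ?_
      simp only [mul_right_comm _ (φ k (x i))]
      rw [← Finset.sum_mul, hv1 k (Finset.mem_range.mp hk), zero_mul]
    rw [e, hS, Finset.mul_sum]
    refine (Finset.abs_sum_le_sum_abs _ _).trans (Finset.sum_le_sum fun j _ => ?_)
    rw [abs_mul]
    exact mul_le_mul_of_nonneg_right (hε _ _) (abs_nonneg _)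
  rw [Finset.sum_range] at hsum
  simp only [Fin.ofNat_eq_cast, Fin.cast_val_eq_self] at hsum
  rw [← hS, mul_right_comm, le_mul_iff_one_le_left hSpos] at hsum
  have hε0 : 0 ≤ ε := (abs_nonneg _).trans (hε (x 0) (y 0))
  set D := |crossError f x y m (x m) (y m)| with hD
  have hDpos : 0 < D := abs_pos.mpr (hd m le_rfl)
  have hρ := two_le_growthFactor hm
  have hgrowth : ∀ k < m, D ≤ growthFactor m * |crossError f x y k (x k) (y k)| := by
    intro k hk
    obtain ⟨b, rfl⟩ := Nat.exists_eq_add_of_le hk.le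
    have := abs_pivot_le_growthFactor_add_mul k h.shift
      (fun i hi => by rw [crossError_crossError]; exact hd _ (by omega)) (by omega)
    rwa [crossError_crossError, add_comm b k] at this
  have hgeom : ∑ k ∈ Finset.range m, (4 : ℝ) ^ k ≤ 4 ^ m / 3 := by
    rw [geom_sum_eq (by norm_num)]
    linarith
  have hquot : D * ∑ k ∈ Finset.range (m + 1), 4 ^ k / |crossError f x y k (x k) (y k)| ≤
      4 ^ m * growthFactor m := by
    rw [Finset.sum_range_succ, ← hD, mul_add, mul_div_cancel₀ _ hDpos.ne', Finset.mul_sum]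
    have h1 : ∑ k ∈ Finset.range m, D * (4 ^ k / |crossError f x y k (x k) (y k)|) ≤
        growthFactor m * ∑ k ∈ Finset.range m, 4 ^ k := by
      rw [Finset.mul_sum]
      refine Finset.sum_le_sum fun k hk => ?_
      have hk := Finset.mem_range.mp hk
      rw [mul_div_assoc', div_le_iff₀ (abs_pos.mpr (hd k hk.le)), mul_right_comm]
      exact mul_le_mul_of_nonneg_right (hgrowth k hk) (by positivity)
    -- The last pivot contributes `4 ^ m`, at most half of the claim as `growthFactor m ≥ 2`.
    have h2 := mul_le_mul_of_nonneg_left hgeom (zero_le_two.trans hρ)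
    have h3 : 0 < (4 : ℝ) ^ m := by positivity
    nlinarith
  calc D = D * 1 := (mul_one D).symm
    _ ≤ D * (ε * ∑ k ∈ Finset.range (m + 1), 4 ^ k / |crossError f x y k (x k) (y k)|) :=
      mul_le_mul_of_nonneg_left hsum hDpos.le
    _ = D * (∑ k ∈ Finset.range (m + 1), 4 ^ k / |crossError f x y k (x k) (y k)|) * ε := by ring
    _ ≤ 4 ^ m * growthFactor m * ε := mul_le_mul_of_nonneg_right hquot hε0

theorem IsCompletePivoting.abs_crossError_le_of_separable_approximation {X Y : Type*}
    {f : X → Y → ℝ} {x : ℕ → X} {y : ℕ → Y} {m : ℕ} (h : IsCompletePivoting f x y m) (hm : 0 < m)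
    (φ : ℕ → X → ℝ) (a : ℕ → Y → ℝ) {ε : ℝ}
    (hε : ∀ s t, |f s t - ∑ k ∈ Finset.range m, a k t * φ k s| ≤ ε) (s : X) (t : Y) :
    |crossError f x y m s t| ≤ 4 ^ m * growthFactor m * ε := by
  by_cases hne : crossError f x y m s t = 0
  · rw [hne, abs_zero]
    have := two_le_growthFactor hm
    have := (abs_nonneg _).trans (hε s t)
    positivity
  -- The position `(s, t)` may serve as the pivot of the next step.
  have hx : ∀ i < m, x i = Function.update x m s i := fun i hi =>
    (Function.update_of_ne hi.ne _ _).symm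
  have hy : ∀ i < m, y i = Function.update y m t i := fun i hi =>
    (Function.update_of_ne hi.ne _ _).symm
  have hm' := crossError_congr f hx hy
  have key := (h.congr hx hy).abs_pivot_le_of_separable_approximation ?_ hm φ a hε
  · rwa [← hm', Function.update_self, Function.update_self] at key
  · intro k hk
    rcases hk.lt_or_eq with hk | rfl
    · exact (h.congr hx hy).pivot_ne_zero hk (hm' ▸ hne)
    · rwa [← hm', Function.update_self, Function.update_self]

end SeparableApproximation

/-! ### The error bound on the square -/

theorem corollary3p8
    (f : Set.Icc (-1 : ℝ) 1 → Set.Icc (-1 : ℝ) 1 → ℝ)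
    (F : ℂ → Set.Icc (-1 : ℝ) 1 → ℂ)
    (r₀ r M : ℝ) (hr : 1 < r) (hr₀ : r < r₀)
    -- for each `y`, `F (·, y)` is an analytic extension of `f (·, y)` to the Bernstein ellipse
    (hF : ∀ y, AnalyticOnNhd ℂ (fun z => F z y) (bernsteinEllipse r₀))
    (hFf : ∀ s y : Set.Icc (-1 : ℝ) 1, F ((s : ℝ) : ℂ) y = ((f s y : ℝ) : ℂ))
    -- `M` is the supremum of `|F|` on `∂E_r × [-1, 1]`
    (hM : IsLUB {c : ℝ | ∃ η ∈ frontier (bernsteinEllipse r), ∃ ξ, c = ‖F η ξ‖} M)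
    (m : ℕ) (hm : 0 < m)
    (x y : ℕ → Set.Icc (-1 : ℝ) 1)
    (hxy : IsCompletePivoting f x y m) :
    BddAbove (Set.range fun p : Set.Icc (-1 : ℝ) 1 × Set.Icc (-1 : ℝ) 1 =>
        |crossError f x y m p.1 p.2|) ∧
      maxNorm (crossError f x y m) ≤
        2 * M * growthFactor m / (1 - 1 / r) * (r / 4) ^ (-(m : ℤ)) := by
  choose a ha using fun t => exists_chebyshev_approximation (hF t) hr hr₀
    (fun η hη => hM.1 ⟨η, hη, t, rfl⟩) hm
  have key := hxy.abs_crossError_le_of_separable_approximation hm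
    (fun k s => Real.cos (k * Real.arccos s)) (fun k t => a t k)
    (ε := 2 * M * r⁻¹ ^ m / (1 - r⁻¹)) fun s t => by
      have := ha t (Real.arccos s)
      rwa [Real.cos_arccos s.2.1 s.2.2, hFf s t, Complex.ofReal_re] at this
  have e : 2 * M * growthFactor m / (1 - 1 / r) * (r / 4) ^ (-(m : ℤ)) =
      4 ^ m * growthFactor m * (2 * M * r⁻¹ ^ m / (1 - r⁻¹)) := by
    rw [zpow_neg, zpow_natCast, div_pow, inv_div, inv_pow, one_div]
    ring
  rw [e]
  refine ⟨⟨_, Set.forall_mem_range.mpr fun p => key p.1 p.2⟩, maxNorm_le ?_ key⟩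
  exact (abs_nonneg _).trans (key (x 0) (y 0))
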